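/- Let $k$ be a positive integer and let $T\subseteq\mathbb{Z}^k$ be a finite set whose affine dimension (the dimension of its affine span in $\mathbb{R}^k$) is at least $3$, or which has at least $5$ distinct points. Then there is a constant $c=c_T>0$, depending only on $T$ (and $k$), such that the following holds for every real $\delta$ with $0<\delta<1/2$. There is an $N_0=N_0(T,\delta)$ such that for every integer $N\ge N_0$ there exists a set $A\subseteq[N]^k$, where $[N]:=\{1,2,\dots,N\}$, with $|A|\ge\delta N^k$ such that for every nonzero integer $d$ the number of points $x\in\mathbb{Z}^k$ with $$x+d\cdot T:=\{x+dt: t\in T\}\subseteq A$$ is at most $\delta^{c\log(1/\delta)}N^k$. -/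

import Mathlib

/-- The box `[N]^k = {1, …, N}^k`, as a finite subset of `ℤ^k`. -/
noncomputable def gridBox (k N : ℕ) : Finset (Fin k → ℤ) :=
  Fintype.piFinset fun _ => Finset.Icc 1 (N : ℤ)

/-- The affine dimension of a finite pattern `T ⊆ ℤ^k`: the dimension of its affine span in `ℝ^k`. -/
noncomputable def affineDim {k : ℕ} (T : Finset (Fin k → ℤ)) : ℕ :=
  Module.finrank ℝ
    (affineSpan ℝ ((fun (t : Fin k → ℤ) (i : Fin k) => (t i : ℝ)) '' (T : Set (Fin k → ℤ)))).direction

/-- The set of points `x ∈ ℤ^k` such that `x + d · T = {x + d t : t ∈ T}` is contained in `A`. -/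
noncomputable def patternTranslates {k : ℕ} (T A : Finset (Fin k → ℤ)) (d : ℤ) : Set (Fin k → ℤ) :=
  {x | ∀ t ∈ T, x + d • t ∈ A}

/-! Fix a product `u * v` of two integer linear forms and a prime `p` in `(N, 2N]`, and let `A` be
the set of `x` in the box with `u x * v x + γ` in `W` mod `p`. Here `W` is a Behrend-type set:
intervals of length `h` starting at multiples of base-`D` numbers whose digit vectors lie on one
sphere.

Since `u * v` is quadratic, its values at `x + d t`, for suitable `t` in `T`, satisfy the same
linear relations for all `x` and `d`. If these relations force two variables to coincide on spheres,
then two of the values differ by less than `h` mod `p` (`exists_residue_set`). That difference is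
affine in `x` and nonconstant mod `p`, so at most about `h N^(k-1)` points `x` survive
(`RigidPattern.exists_set`). With `n` digits below `m`, the density is about `K^(-n) n^(-1) m^(-2)`
and the popularity at most `4 m^(-n)`. Taking `m = K^n` turns these into `K^(-O(n))` and about
`K^(-n^2)`, and `n` of order `log(1/δ)` gives the claim.

Rigid relations come from four affinely independent points, via the centroid of a triangle, or from
five points, via quadratic interpolation on a line. -/

/-- A family of linear relations forces `y i₁ = y i₀` for all solutions `y` in integer vectors which
lie on a common sphere about the origin. -/
def ForcesEqOnSpheres {ι κ : Type} [Fintype ι] (coeff : κ → ι → ℤ) (i₀ i₁ : ι) : Prop :=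
  ∀ (n : ℕ) (r : ℤ) (y : ι → Fin n → ℤ), (∀ j s, ∑ i, coeff j i * y i s = 0) →
    (∀ i, ∑ s, y i s ^ 2 = r) → y i₁ = y i₀

/-! ### Behrend-type sets in `ℤ/p`. -/

theorem digits_eq_zero {D : ℤ} : ∀ {n : ℕ} (c : Fin n → ℤ), (∀ i, |c i| < D) →
    ∑ i, c i * D ^ (i : ℕ) = 0 → ∀ i, c i = 0 := by
  intro n
  induction n with
  | zero => intro c _ _ i; exact i.elim0
  | succ n ih =>
    intro c hc h
    have hD : 0 < D := lt_of_le_of_lt (abs_nonneg _) (hc 0)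
    have e : c 0 + D * ∑ i : Fin n, c i.succ * D ^ (i : ℕ) = 0 := by
      rw [← h, Fin.sum_univ_succ, Finset.mul_sum]
      simp only [Fin.val_zero, pow_zero, mul_one, Fin.val_succ, pow_succ]
      congr 1
      exact Finset.sum_congr rfl fun i _ => by ring
    have h0 : c 0 = 0 := Int.eq_zero_of_abs_lt_dvd
      ⟨-∑ i : Fin n, c i.succ * D ^ (i : ℕ), by linarith⟩ (hc 0)
    rw [h0, zero_add] at e
    have h1 := ih (fun i => c i.succ) (fun i => hc _) ((mul_eq_zero.1 e).resolve_left hD.ne')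
    intro i
    exact Fin.cases h0 h1 i

theorem abs_sum_mul_lt {ι : Type} [Fintype ι] {K X : ℤ} (a z : ι → ℤ) (hX : 0 < X)
    (ha : ∑ i, |a i| ≤ K) (hz : ∀ i, 0 ≤ z i) (hzX : ∀ i, K * z i < X) :
    |∑ i, a i * z i| < X := by
  by_cases hι : Nonempty ι
  · obtain ⟨i₀, -, hi₀⟩ := Finset.exists_max_image Finset.univ z Finset.univ_nonempty
    calc |∑ i, a i * z i| ≤ ∑ i, |a i * z i| := Finset.abs_sum_le_sum_abs _ _
      _ ≤ ∑ i, |a i| * z i₀ := by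
          refine Finset.sum_le_sum fun i hi => ?_
          rw [abs_mul, abs_of_nonneg (hz i)]
          exact mul_le_mul_of_nonneg_left (hi₀ i hi) (abs_nonneg _)
      _ = (∑ i, |a i|) * z i₀ := by rw [Finset.sum_mul]
      _ ≤ K * z i₀ := mul_le_mul_of_nonneg_right ha (hz i₀)
      _ < X := hzX i₀
  · rw [not_nonempty_iff] at hι
    simpa using hX

theorem behrend_map_lt {n D : ℕ} (y : Fin n → ℕ) (hy : ∀ i, y i < D) :
    Behrend.map D y < D ^ n := by
  induction n with
  | zero => simp
  | succ n ih =>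
    rw [Behrend.map_succ']
    have h1 := ih (y ∘ Fin.succ) (fun i => hy _)
    have h2 := hy 0
    calc y 0 + Behrend.map D (y ∘ Fin.succ) * D < D + Behrend.map D (y ∘ Fin.succ) * D := by omega
      _ = (Behrend.map D (y ∘ Fin.succ) + 1) * D := by ring
      _ ≤ D ^ n * D := Nat.mul_le_mul_right _ h1
      _ = D ^ (n + 1) := by ring

/-- In `ℤ/p` there is a fairly dense union `W` of short intervals of length `h`, so that any
solution in `W` of a given sphere-rigid system has two variables at distance less than `h`. -/
theorem exists_residue_set (K n m p : ℕ) (hK : 1 ≤ K) (hn : 1 ≤ n) (hm : 1 ≤ m)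
    (hp : K ^ 2 * (K * m) ^ n ≤ p) :
    ∃ (h : ℕ) (W : Finset (ZMod p)), p ≤ 2 * (h * (K ^ 2 * (K * m) ^ n)) ∧
      h * (K ^ 2 * (K * m) ^ n) ≤ p ∧ h * m ^ n ≤ W.card * (n * m ^ 2) ∧
      ∀ {ι κ : Type} [Fintype ι] (coeff : κ → ι → ℤ) (i₀ i₁ : ι),
        (∀ j, ∑ i, |coeff j i| ≤ K) → ForcesEqOnSpheres coeff i₀ i₁ →
        ∀ z : ι → ZMod p, (∀ i, z i ∈ W) → (∀ j, ∑ i, (coeff j i : ZMod p) * z i = 0) →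
          ∃ e : ℤ, -(h : ℤ) < e ∧ e < h ∧ z i₁ - z i₀ = (e : ZMod p) := by
  -- A factor `K` of room at each of three scales (values below `p / K`, offsets below `w / K`,
  -- digits below `D / K`) prevents wraparound and carries, so a relation mod `p` splits into
  -- relations digit by digit.
  set D := K * m with hD
  have hD0 : 0 < D := by positivity
  have hDn : 0 < D ^ n := by positivity
  have hp0 : 0 < p := lt_of_lt_of_le (by positivity) hp
  have : NeZero p := ⟨hp0.ne'⟩
  set w := p / (K * D ^ n) with hw
  set h := w / K with hh
  have hhp : h = p / (K ^ 2 * D ^ n) := by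
    rw [hh, hw, Nat.div_div_eq_div_mul]; congr 1; ring
  have hh0 : 0 < h := by rw [hhp]; exact Nat.div_pos hp (by positivity)
  have hKh : K * h ≤ w := Nat.mul_div_le _ _
  have hwp : K * (w * D ^ n) ≤ p := by
    calc K * (w * D ^ n) = K * D ^ n * w := by ring
      _ ≤ p := Nat.mul_div_le _ _
  have hhw : h ≤ w := Nat.div_le_self _ _
  obtain ⟨r, hr⟩ := Behrend.exists_large_sphere n m
  have hcard : m ^ n ≤ (Behrend.sphere n m r).card * (n * m ^ 2) := by
    have h2 : (0 : ℝ) < ((n * m ^ 2 : ℕ) : ℝ) := by positivity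
    rw [div_le_iff₀ h2] at hr
    exact_mod_cast hr
  set φ : (Fin n → ℕ) × ℕ → ℕ := fun q => w * Behrend.map D q.1 + q.2 with hφ
  set S := Behrend.sphere n m r ×ˢ Finset.range h with hS
  have hmD : m ≤ D := Nat.le_mul_of_pos_left m (by omega)
  have hdig : ∀ q ∈ S, (∀ i, q.1 i < m) ∧ ∑ i, q.1 i ^ 2 = r ∧ q.2 < h := by
    intro q hq
    simp only [hS, Finset.mem_product, Behrend.sphere, Finset.mem_filter, Behrend.mem_box,
      Finset.mem_range] at hq
    tauto
  have hφlt : ∀ q ∈ S, K * φ q < p := by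
    intro q hq
    obtain ⟨h1, -, h3⟩ := hdig q hq
    have h4 := behrend_map_lt q.1 (D := D) (fun i => (h1 i).trans_le hmD)
    refine lt_of_lt_of_le (Nat.mul_lt_mul_of_pos_left ?_ (by omega)) hwp
    calc φ q < w * Behrend.map D q.1 + w := by simp only [hφ]; omega
      _ = w * (Behrend.map D q.1 + 1) := by ring
      _ ≤ w * D ^ n := Nat.mul_le_mul_left _ h4
  have hφlt' : ∀ q ∈ S, φ q < p := fun q hq =>
    lt_of_le_of_lt (Nat.le_mul_of_pos_left _ (by omega)) (hφlt q hq)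
  have hinj : Set.InjOn (fun q => (φ q : ZMod p)) (S : Set ((Fin n → ℕ) × ℕ)) := by
    intro q hq q' hq' he
    have hq := Finset.mem_coe.1 hq
    have hq' := Finset.mem_coe.1 hq'
    have h1 : φ q = φ q' := by
      have := (ZMod.natCast_eq_natCast_iff' _ _ _).1 he
      rwa [Nat.mod_eq_of_lt (hφlt' q hq), Nat.mod_eq_of_lt (hφlt' q' hq')] at this
    obtain ⟨a1, -, a3⟩ := hdig q hq
    obtain ⟨b1, -, b3⟩ := hdig q' hq'
    have hw0 : 0 < w := by omega
    have e1 : φ q / w = Behrend.map D q.1 := by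
      simp only [hφ]
      rw [Nat.mul_add_div hw0, Nat.div_eq_of_lt (by omega), add_zero]
    have e2 : φ q' / w = Behrend.map D q'.1 := by
      simp only [hφ]
      rw [Nat.mul_add_div hw0, Nat.div_eq_of_lt (by omega), add_zero]
    have e3 : Behrend.map D q.1 = Behrend.map D q'.1 := by rw [← e1, ← e2, h1]
    have e4 := Behrend.map_injOn (fun i => (a1 i).trans_le hmD) (fun i => (b1 i).trans_le hmD) e3
    refine Prod.ext e4 ?_
    simp only [hφ, e3] at h1
    omega
  refine ⟨h, S.image (fun q => (φ q : ZMod p)), ?_, ?_, ?_, ?_⟩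
  -- Since `h ≥ 1`, rounding down loses at most a factor 2.
  · have h1 := Nat.lt_mul_div_succ p (show 0 < K ^ 2 * D ^ n by positivity)
    rw [← hhp] at h1
    nlinarith [Nat.mul_le_mul_left (K ^ 2 * D ^ n) (show h + 1 ≤ 2 * h by omega)]
  · rw [hhp]; exact Nat.div_mul_le_self _ _
  · rw [Finset.card_image_of_injOn hinj, hS, Finset.card_product, Finset.card_range]
    calc h * m ^ n ≤ h * ((Behrend.sphere n m r).card * (n * m ^ 2)) := Nat.mul_le_mul_left _ hcard
      _ = _ := by ring
  · intro ι κ _ coeff i₀ i₁ hco hrig z hz hrel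
    have hz' : ∀ i, ∃ q ∈ S, (φ q : ZMod p) = z i := fun i => Finset.mem_image.1 (hz i)
    choose q hqS hqz using hz'
    have hrel1 : ∀ j, ∑ i, coeff j i * (φ (q i) : ℤ) = 0 := by
      intro j
      refine Int.eq_zero_of_abs_lt_dvd (m := p) ?_
        (abs_sum_mul_lt (K := K) _ _ (by exact_mod_cast hp0) (hco j) (fun i => by positivity)
          (fun i => by exact_mod_cast hφlt _ (hqS i)))
      rw [← ZMod.intCast_zmod_eq_zero_iff_dvd]
      push_cast
      rw [← hrel j]
      exact Finset.sum_congr rfl fun i _ => by rw [hqz]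
    have hrel2 : ∀ j, ∑ i, coeff j i * (Behrend.map D (q i).1 : ℤ) = 0 := by
      intro j
      have h1 : (w : ℤ) * ∑ i, coeff j i * (Behrend.map D (q i).1 : ℤ)
          + ∑ i, coeff j i * ((q i).2 : ℤ) = 0 := by
        rw [← hrel1 j, Finset.mul_sum, ← Finset.sum_add_distrib]
        exact Finset.sum_congr rfl fun i _ => by simp only [hφ]; push_cast; ring
      have hw0 : (0 : ℤ) < w := by exact_mod_cast (show 0 < w by omega)
      have h2 : ∑ i, coeff j i * ((q i).2 : ℤ) = 0 := by
        refine Int.eq_zero_of_abs_lt_dvd (m := w)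
          ⟨-∑ i, coeff j i * (Behrend.map D (q i).1 : ℤ), by linarith⟩
          (abs_sum_mul_lt (K := K) _ _ hw0 (hco j) (fun i => by positivity) (fun i => ?_))
        have h3 := (hdig _ (hqS i)).2.2
        have h4 : K * (q i).2 < K * h := Nat.mul_lt_mul_of_pos_left h3 (by omega)
        exact_mod_cast h4.trans_le hKh
      rw [h2, add_zero] at h1
      exact (mul_eq_zero.1 h1).resolve_left hw0.ne'
    have hrel3 : ∀ j s, ∑ i, coeff j i * ((q i).1 s : ℤ) = 0 := by
      intro j
      refine digits_eq_zero (D := D) _ (fun s => ?_) ?_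
      · refine abs_sum_mul_lt (K := K) _ _ (by exact_mod_cast hD0) (hco j) (fun i => by positivity)
          (fun i => ?_)
        have h3 := (hdig _ (hqS i)).1 s
        exact_mod_cast Nat.mul_lt_mul_of_pos_left h3 (show 0 < K by omega)
      · rw [← hrel2 j]
        simp only [Behrend.map_apply, Nat.cast_sum, Finset.mul_sum, Finset.sum_mul]
        rw [Finset.sum_comm]
        refine Finset.sum_congr rfl fun i _ => Finset.sum_congr rfl fun s _ => ?_
        push_cast; ring
    have hy := hrig n r (fun i s => ((q i).1 s : ℤ)) hrel3
      (fun i => by exact_mod_cast (hdig _ (hqS i)).2.1)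
    have hy' : (q i₁).1 = (q i₀).1 := by
      ext s
      have := congrFun hy s
      exact_mod_cast this
    have h0 := (hdig _ (hqS i₀)).2.2
    have h1 := (hdig _ (hqS i₁)).2.2
    refine ⟨((q i₁).2 : ℤ) - (q i₀).2, by omega, by omega, ?_⟩
    rw [← hqz, ← hqz]
    simp only [hφ, hy']
    push_cast
    ring

/-! ### From a rigid pattern to a set with few translates. -/

/-- Points of `T` together with a product `u * v` of two linear forms whose values at `x + d t`
satisfy a family of linear relations that is rigid on spheres; `K` bounds the coefficients, and
`ndeg` says that `(u * v) (x + d τ i₁) - (u * v) (x + d τ i₀)` depends on the coordinate `x c`. -/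
structure RigidPattern {k : ℕ} (T : Finset (Fin k → ℤ)) where
  ι : Type
  [fintype : Fintype ι]
  κ : Type
  τ : ι → Fin k → ℤ
  mem : ∀ i, τ i ∈ T
  coeff : κ → ι → ℤ
  K : ℕ
  coeff_le : ∀ j, ∑ i, |coeff j i| ≤ K
  u : (Fin k → ℤ) →ₗ[ℤ] ℤ
  v : (Fin k → ℤ) →ₗ[ℤ] ℤ
  sum_coeff : ∀ j, ∑ i, coeff j i = 0
  sum_u : ∀ j, ∑ i, coeff j i * u (τ i) = 0
  sum_v : ∀ j, ∑ i, coeff j i * v (τ i) = 0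
  sum_uv : ∀ j, ∑ i, coeff j i * (u (τ i) * v (τ i)) = 0
  i₀ : ι
  i₁ : ι
  rigid : ForcesEqOnSpheres coeff i₀ i₁
  c : Fin k
  ndeg : (u (τ i₁) - u (τ i₀)) * v (Pi.single c 1) + (v (τ i₁) - v (τ i₀)) * u (Pi.single c 1) ≠ 0

attribute [instance] RigidPattern.fintype

theorem mem_gridBox {k N : ℕ} {x : Fin k → ℤ} : x ∈ gridBox k N ↔ ∀ i, 1 ≤ x i ∧ x i ≤ N := by
  simp [gridBox]

theorem card_gridBox (k N : ℕ) : (gridBox k N).card = N ^ k := by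
  simp [gridBox]

/-- With the other coordinates fixed, `g` is affine in `x c` with slope invertible mod `p`, and `N <
p` makes it injective mod `p`. -/
theorem card_gridBox_filter_residue_le {k N p : ℕ} (hp : p.Prime) (hN : N < p) (c : Fin k)
    (g : (Fin k → ℤ) → ℤ) (a : ℤ) (ha : ¬ (p : ℤ) ∣ a)
    (hg : ∀ x s, g (x + s • Pi.single c 1) = g x + a * s) (R : Finset (ZMod p)) :
    ((gridBox k N).filter (fun x => (g x : ZMod p) ∈ R)).card ≤ N ^ (k - 1) * R.card := by
  obtain ⟨k, rfl⟩ : ∃ l, k = l + 1 := ⟨k - 1, by have := c.pos; omega⟩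
  rw [Nat.add_sub_cancel, ← card_gridBox, ← Finset.card_product]
  refine Finset.card_le_card_of_injOn (fun x => (c.removeNth x, (g x : ZMod p))) ?_ ?_
  · intro x hx
    have hx := Finset.mem_filter.1 (Finset.mem_coe.1 hx)
    refine Finset.mem_coe.2 (Finset.mem_product.2 ⟨?_, hx.2⟩)
    rw [mem_gridBox]
    intro i
    exact mem_gridBox.1 hx.1 _
  · intro x hx y hy hxy
    have hx := mem_gridBox.1 (Finset.mem_filter.1 (Finset.mem_coe.1 hx)).1 c
    have hy := mem_gridBox.1 (Finset.mem_filter.1 (Finset.mem_coe.1 hy)).1 c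
    simp only [Prod.mk.injEq] at hxy
    obtain ⟨h1, h2⟩ := hxy
    have h3 : y = x + (y c - x c) • Pi.single c 1 := by
      ext i
      by_cases hi : i = c
      · subst hi; simp
      · obtain ⟨j, rfl⟩ := Fin.exists_succAbove_eq hi
        have := congrFun h1 j
        simp only [Fin.removeNth] at this
        simp [this]
    have h4 : g y = g x + a * (y c - x c) := by
      conv_lhs => rw [h3]
      exact hg _ _
    have h5 : (p : ℤ) ∣ a * (y c - x c) := by
      rw [← ZMod.intCast_zmod_eq_zero_iff_dvd]
      have h6 : (g y : ZMod p) = g x + ((a * (y c - x c) : ℤ) : ZMod p) := by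
        rw [h4]; push_cast; ring
      rw [h2] at h6
      simpa using h6
    have h6 : y c - x c = 0 := by
      refine Int.eq_zero_of_abs_lt_dvd (((Nat.prime_iff_prime_int.1 hp).dvd_or_dvd h5).resolve_left ha) ?_
      rw [abs_lt]
      constructor <;> omega
    rw [h3, h6]
    simp

/-- Average over all `γ`. -/
theorem exists_shift_card_le {α : Type*} (G : Finset α) (p : ℕ) [NeZero p] (f : α → ZMod p)
    (W : Finset (ZMod p)) :
    ∃ γ, G.card * W.card ≤ (G.filter (fun x => f x + γ ∈ W)).card * p := by
  have h1 : ∑ γ : ZMod p, (G.filter (fun x => f x + γ ∈ W)).card = G.card * W.card := by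
    simp only [Finset.card_filter]
    rw [Finset.sum_comm, Finset.card_eq_sum_ones, Finset.sum_mul]
    refine Finset.sum_congr rfl fun x _ => ?_
    rw [one_mul, ← Finset.card_filter]
    refine Finset.card_nbij' (fun γ => f x + γ) (fun z => z - f x) ?_ ?_ ?_ ?_
    · intro γ hγ; simpa using hγ
    · intro z hz; simpa using hz
    · intro γ _; simp
    · intro z _; simp
  by_contra! hcon
  have h2 : ∑ γ : ZMod p, (G.filter (fun x => f x + γ ∈ W)).card * p
      < ∑ _γ : ZMod p, G.card * W.card :=
    Finset.sum_lt_sum_of_nonempty Finset.univ_nonempty fun γ _ => hcon γ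
  rw [← Finset.sum_mul, h1, Finset.sum_const, Finset.card_univ, ZMod.card, smul_eq_mul,
    mul_comm] at h2
  exact lt_irrefl _ h2

theorem abs_lt_of_mem_patternTranslates {k N : ℕ} {T A : Finset (Fin k → ℤ)} {d : ℤ}
    (hA : A ⊆ gridBox k N) {s t x : Fin k → ℤ} (hs : s ∈ T) (ht : t ∈ T) (hst : s ≠ t)
    (hx : x ∈ patternTranslates T A d) : |d| < N := by
  obtain ⟨i, hi⟩ := Function.ne_iff.1 hst
  have h1 := mem_gridBox.1 (hA (hx s hs)) i
  have h2 := mem_gridBox.1 (hA (hx t ht)) i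
  simp only [Pi.add_apply, Pi.smul_apply, smul_eq_mul] at h1 h2
  have h3 : |d * (s i - t i)| < N := by
    rw [abs_lt, mul_sub]; constructor <;> linarith
  rw [abs_mul] at h3
  have h4 : 1 ≤ |s i - t i| := Int.one_le_abs (sub_ne_zero.2 hi)
  nlinarith [abs_nonneg d]

theorem finite_and_ncard_patternTranslates_le {k : ℕ} {T A : Finset (Fin k → ℤ)} {d : ℤ}
    {t : Fin k → ℤ} (F : Finset (Fin k → ℤ))
    (hF : ∀ x ∈ patternTranslates T A d, x + d • t ∈ F) :
    (patternTranslates T A d).Finite ∧ (patternTranslates T A d).ncard ≤ F.card := by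
  have hinj : Set.InjOn (fun x => x + d • t) (patternTranslates T A d) :=
    (add_left_injective (d • t)).injOn
  refine ⟨Set.Finite.of_finite_image (F.finite_toSet.subset ?_) hinj, ?_⟩
  · rintro _ ⟨x, hx, rfl⟩
    exact hF x hx
  · rw [← Set.ncard_coe_finset]
    exact Set.ncard_le_ncard_of_injOn _ hF hinj F.finite_toSet

theorem RigidPattern.exists_set {k : ℕ} {T : Finset (Fin k → ℤ)} (R : RigidPattern T)
    {K n m : ℕ} (hRK : R.K ≤ K) (hK : 1 ≤ K) (hn : 1 ≤ n) (hm : 1 ≤ m) :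
    ∃ N₀ : ℕ, ∀ N : ℕ, N₀ ≤ N → ∃ A : Finset (Fin k → ℤ), A ⊆ gridBox k N ∧
      N ^ k ≤ A.card * (2 * K ^ (n + 2) * n * m ^ 2) ∧
      ∀ d : ℤ, d ≠ 0 → (patternTranslates T A d).Finite ∧
        (patternTranslates T A d).ncard * m ^ n ≤ 4 * N ^ k := by
  set U := R.u (R.τ R.i₁) - R.u (R.τ R.i₀) with hU
  set V := R.v (R.τ R.i₁) - R.v (R.τ R.i₀) with hV
  set l := U * R.v (Pi.single R.c 1) + V * R.u (Pi.single R.c 1) with hl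
  have hl0 : l ≠ 0 := R.ndeg
  have hτ : R.τ R.i₀ ≠ R.τ R.i₁ := by
    intro h
    apply hl0
    simp [hl, hU, hV, h]
  -- Any prime `p > N` then exceeds `|l|`, so `p` does not divide `l`, and is large enough for
  -- `exists_residue_set`.
  refine ⟨l.natAbs + K ^ 2 * (K * m) ^ n + 1, fun N hN => ?_⟩
  obtain ⟨p, hp, hNp, hpN⟩ := Nat.exists_prime_lt_and_le_two_mul N (by omega)
  have : NeZero p := ⟨hp.ne_zero⟩
  obtain ⟨h, W, hW1, hW2, hW3, hW⟩ := exists_residue_set K n m p hK hn hm (by omega)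
  obtain ⟨γ, hγ⟩ := exists_shift_card_le (gridBox k N) p
    (fun x => ((R.u x * R.v x : ℤ) : ZMod p)) W
  set A := (gridBox k N).filter (fun x => ((R.u x * R.v x : ℤ) : ZMod p) + γ ∈ W) with hA
  have hAG : A ⊆ gridBox k N := Finset.filter_subset _ _
  refine ⟨A, hAG, ?_, fun d hd => ?_⟩
  · rw [card_gridBox] at hγ
    refine Nat.le_of_mul_le_mul_right ?_ hp.pos
    calc N ^ k * p ≤ N ^ k * (2 * (h * (K ^ 2 * (K * m) ^ n))) := Nat.mul_le_mul_left _ hW1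
      _ = N ^ k * (h * m ^ n) * (2 * K ^ (n + 2)) := by rw [mul_pow]; ring
      _ ≤ N ^ k * (W.card * (n * m ^ 2)) * (2 * K ^ (n + 2)) :=
          Nat.mul_le_mul_right _ (Nat.mul_le_mul_left _ hW3)
      _ = (N ^ k * W.card) * (2 * K ^ (n + 2) * n * m ^ 2) := by ring
      _ ≤ (A.card * p) * (2 * K ^ (n + 2) * n * m ^ 2) := Nat.mul_le_mul_right _ hγ
      _ = _ := by ring
  · by_cases hne : (patternTranslates T A d).Nonempty
    swap
    · rw [Set.not_nonempty_iff_eq_empty.1 hne]; simp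
    obtain ⟨x₀, hx₀⟩ := hne
    have hdN := abs_lt_of_mem_patternTranslates hAG (R.mem _) (R.mem _) hτ hx₀
    have hndvd : ¬ (p : ℤ) ∣ d * l := by
      intro hdvd
      rcases (Nat.prime_iff_prime_int.1 hp).dvd_or_dvd hdvd with h1 | h1
      · exact hd (Int.eq_zero_of_abs_lt_dvd h1 (by omega))
      · exact hl0 (Int.eq_zero_of_abs_lt_dvd h1 (by rw [Int.abs_eq_natAbs]; omega))
    set I : Finset (ZMod p) := (Finset.Ioo (-(h : ℤ)) h).image (fun e : ℤ => (e : ZMod p)) with hI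
    have hIc : I.card ≤ 2 * h := by
      refine Finset.card_image_le.trans ?_
      rw [Int.card_Ioo]; omega
    -- The increment of `u * v` from `x` to `x + d (τ i₁ - τ i₀)`; it is applied below at the base
    -- point shifted by `d τ i₀`.
    set g : (Fin k → ℤ) → ℤ := fun x => d * (U * R.v x + V * R.u x) + d ^ 2 * (U * V) with hg
    have hcount := card_gridBox_filter_residue_le hp hNp R.c g (d * l) hndvd (fun x s => by
      simp only [hg, hl, map_add, map_smul, smul_eq_mul]; ring) I
    have hmain := finite_and_ncard_patternTranslates_le (T := T) (A := A) (d := d)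
      (t := R.τ R.i₀) ((gridBox k N).filter (fun x => (g x : ZMod p) ∈ I)) (by
        intro x hx
        refine Finset.mem_filter.2 ⟨hAG (hx _ (R.mem _)), ?_⟩
        obtain ⟨e, he1, he2, he⟩ := hW R.coeff R.i₀ R.i₁
          (fun j => (R.coeff_le j).trans (by exact_mod_cast hRK)) R.rigid
          (fun i => ((R.u (x + d • R.τ i) * R.v (x + d • R.τ i) : ℤ) : ZMod p) + γ)
          (fun i => (Finset.mem_filter.1 (hx _ (R.mem i))).2) (by
            intro j
            have h1 : ∑ i, R.coeff j i * (R.u (x + d • R.τ i) * R.v (x + d • R.τ i)) = 0 := by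
              calc _ = ∑ i, (R.coeff j i * (R.u x * R.v x)
                    + (R.coeff j i * R.u (R.τ i)) * (d * R.v x)
                    + (R.coeff j i * R.v (R.τ i)) * (d * R.u x)
                    + (R.coeff j i * (R.u (R.τ i) * R.v (R.τ i))) * d ^ 2) := by
                    refine Finset.sum_congr rfl fun i _ => ?_
                    simp only [map_add, map_smul, smul_eq_mul]; ring
                _ = 0 := by
                    rw [Finset.sum_add_distrib, Finset.sum_add_distrib, Finset.sum_add_distrib,
                      ← Finset.sum_mul, ← Finset.sum_mul, ← Finset.sum_mul, ← Finset.sum_mul,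
                      R.sum_coeff, R.sum_u, R.sum_v, R.sum_uv]
                    ring
            -- The shift `γ` drops out because the coefficients sum to zero.
            have h2 := congrArg (fun e : ℤ => (e : ZMod p)) h1
            have h3 := congrArg (fun e : ℤ => (e : ZMod p)) (R.sum_coeff j)
            simp only [Int.cast_sum, Int.cast_mul, Int.cast_zero] at h2 h3
            simp only [mul_add, Finset.sum_add_distrib, ← Finset.sum_mul, h3, zero_mul, add_zero,
              Int.cast_mul]
            exact h2)
        refine Finset.mem_image.2 ⟨e, Finset.mem_Ioo.2 ⟨he1, he2⟩, ?_⟩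
        rw [← he]
        simp only [hg, hU, hV, map_add, map_smul, smul_eq_mul]
        push_cast
        ring)
    refine ⟨hmain.1, ?_⟩
    have hk : N ^ k = N ^ (k - 1) * N := by
      rw [← pow_succ]; congr 1; have := R.c.pos; omega
    have hhm : h * m ^ n ≤ 2 * N := by
      refine le_trans ?_ (hW2.trans hpN)
      refine Nat.mul_le_mul_left _ ?_
      calc m ^ n ≤ (K * m) ^ n := Nat.pow_le_pow_left (Nat.le_mul_of_pos_left _ (by omega)) _
        _ ≤ _ := Nat.le_mul_of_pos_left _ (by positivity)
    calc _ ≤ (N ^ (k - 1) * (2 * h)) * m ^ n :=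
          Nat.mul_le_mul_right _ (hmain.2.trans (hcount.trans (Nat.mul_le_mul_left _ hIc)))
      _ = 2 * N ^ (k - 1) * (h * m ^ n) := by ring
      _ ≤ 2 * N ^ (k - 1) * (2 * N) := Nat.mul_le_mul_left _ hhm
      _ = 4 * N ^ k := by rw [hk]; ring

/-! ### Integer linear forms with prescribed behaviour. -/

theorem exists_apply_single_ne_zero {k : ℕ} (f : (Fin k → ℤ) →ₗ[ℤ] ℤ) {x : Fin k → ℤ}
    (hx : f x ≠ 0) : ∃ c, f (Pi.single c 1) ≠ 0 := by
  by_contra! h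
  apply hx
  have : f = 0 := LinearMap.pi_ext' fun i => LinearMap.ext_ring (by simpa using h i)
  rw [this, LinearMap.zero_apply]

/-- The linear form with coefficient vector `w`. -/
def dotForm {k : ℕ} (w : Fin k → ℤ) : (Fin k → ℤ) →ₗ[ℤ] ℤ := ∑ c, w c • LinearMap.proj c

theorem dotForm_apply {k : ℕ} (w x : Fin k → ℤ) : dotForm w x = ∑ c, w c * x c := by
  simp [dotForm]

/-- Read coordinates as digits in a base exceeding all their differences. -/
theorem exists_injOn_dotForm {k : ℕ} (T : Finset (Fin k → ℤ)) :
    ∃ w : Fin k → ℤ, Set.InjOn (dotForm w) (T : Set (Fin k → ℤ)) := by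
  set B : ℤ := ∑ t ∈ T, ∑ c, |t c| with hB
  have hTB : ∀ t ∈ T, ∀ c, |t c| ≤ B := fun t ht c =>
    (Finset.single_le_sum (f := fun c => |t c|) (fun _ _ => abs_nonneg _) (Finset.mem_univ c)).trans
      (Finset.single_le_sum (f := fun t : Fin k → ℤ => ∑ c, |t c|)
        (fun _ _ => Finset.sum_nonneg fun _ _ => abs_nonneg _) ht)
  refine ⟨fun c => (2 * B + 1) ^ (c : ℕ), fun s hs t ht hst => ?_⟩
  rw [dotForm_apply, dotForm_apply] at hst
  have h := digits_eq_zero (D := 2 * B + 1) (fun c => s c - t c) (fun c => by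
    have h1 := hTB s hs c
    have h2 := hTB t ht c
    have h3 := abs_sub (s c) (t c)
    linarith) (by
    rw [← sub_eq_zero.2 hst, ← Finset.sum_sub_distrib]
    exact Finset.sum_congr rfl fun c _ => by ring)
  funext c
  exact sub_eq_zero.1 (h c)

/-- Independence makes the Gram determinant nonzero; it serves as `M`, and the adjugate clears
denominators. -/
theorem exists_dotForm_eq {k q : ℕ} (s : Fin q → Fin k → ℤ) (hs : LinearIndependent ℤ s) :
    ∃ M : ℤ, M ≠ 0 ∧ ∀ a : Fin q → ℤ, ∃ w : Fin k → ℤ, ∀ i, dotForm w (s i) = M * a i := by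
  set S : Matrix (Fin q) (Fin k) ℤ := Matrix.of s with hS
  refine ⟨(S * S.transpose).det, ?_, fun a => ?_⟩
  · intro h
    obtain ⟨v, hv, hv0⟩ := Matrix.exists_mulVec_eq_zero_iff.2 h
    have h1 : (S.transpose.mulVec v) ⬝ᵥ (S.transpose.mulVec v) = 0 := by
      rw [Matrix.dotProduct_mulVec, Matrix.vecMul_transpose, Matrix.mulVec_mulVec, hv0,
        zero_dotProduct]
    rw [dotProduct_self_eq_zero] at h1
    apply hv
    have h2 := Fintype.linearIndependent_iff.1 hs v (by
      funext c
      have := congrFun h1 c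
      simp only [Matrix.mulVec, dotProduct, Matrix.transpose_apply, hS, Matrix.of_apply,
        Pi.zero_apply] at this
      simp only [Finset.sum_apply, Pi.smul_apply, smul_eq_mul, Pi.zero_apply]
      rw [← this]
      exact Finset.sum_congr rfl fun i _ => mul_comm _ _)
    exact funext h2
  · refine ⟨S.transpose.mulVec ((S * S.transpose).adjugate.mulVec a), fun i => ?_⟩
    have h1 : S.mulVec (S.transpose.mulVec ((S * S.transpose).adjugate.mulVec a))
        = (S * S.transpose).det • a := by
      rw [Matrix.mulVec_mulVec, Matrix.mulVec_mulVec, Matrix.mul_adjugate, Matrix.smul_mulVec,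
        Matrix.one_mulVec]
    have h2 := congrFun h1 i
    rw [Pi.smul_apply, smul_eq_mul] at h2
    rw [← h2, dotForm_apply]
    exact Finset.sum_congr rfl fun c _ => mul_comm _ _

/-! ### Rigidity from affine dimension at least 3. -/

theorem exists_affineIndependent_points {k : ℕ} {T : Finset (Fin k → ℤ)} (hT : 3 ≤ affineDim T) :
    ∃ τ : Fin 4 → Fin k → ℤ, (∀ i, τ i ∈ T) ∧
      LinearIndependent ℤ (fun i : Fin 3 => τ i.succ - τ 0) := by
  set φ : (Fin k → ℤ) →ₗ[ℤ] (Fin k → ℝ) :=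
    { toFun := fun t i => (t i : ℝ)
      map_add' := fun x y => by ext; simp
      map_smul' := fun x y => by ext; simp } with hφ
  obtain ⟨t, htS, htspan, hind⟩ :=
    exists_affineIndependent ℝ (Fin k → ℝ) (φ '' (T : Set (Fin k → ℤ)))
  have htf : t.Finite := (T.finite_toSet.image φ).subset htS
  have := htf.fintype
  have hdim : 3 ≤ Module.finrank ℝ (vectorSpan ℝ t) := by
    rw [← direction_affineSpan, htspan]
    exact hT
  have hcard : 4 ≤ Fintype.card t := by
    by_contra! hlt
    rcases Nat.eq_zero_or_pos (Fintype.card t) with h0 | h0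
    · have : t = ∅ := by
        rw [← Set.isEmpty_coe_sort]; exact Fintype.card_eq_zero_iff.1 h0
      rw [this, vectorSpan_empty] at hdim
      simp at hdim
    · have h1 := hind.finrank_vectorSpan (Nat.succ_pred_eq_of_pos h0).symm
      rw [Subtype.range_coe] at h1
      rw [h1] at hdim
      rw [Nat.pred_eq_sub_one] at hdim
      omega
  obtain ⟨e⟩ : Nonempty (Fin 4 ↪ t) :=
    Function.Embedding.nonempty_of_card_le (by simpa using hcard)
  have h4 : AffineIndependent ℝ (fun i => (e i : Fin k → ℝ)) := hind.comp_embedding e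
  have hpre : ∀ i, ∃ x ∈ T, φ x = e i := fun i => htS (e i).2
  choose τ hτT hτ using hpre
  refine ⟨τ, hτT, ?_⟩
  rw [affineIndependent_iff_linearIndependent_vsub ℝ _ (0 : Fin 4)] at h4
  have h5 := h4.comp (fun i : Fin 3 => (⟨i.succ, Fin.succ_ne_zero i⟩ : {x : Fin 4 // x ≠ 0}))
    (fun i j hij => Fin.succ_injective _ (Subtype.ext_iff.1 hij))
  have h6 : LinearIndependent ℤ (φ ∘ fun i : Fin 3 => τ i.succ - τ 0) := by
    have h7 := h5.restrict_scalars (R := ℤ) (by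
      intro a b hab
      simpa using hab)
    have h8 : (φ ∘ fun i : Fin 3 => τ i.succ - τ 0) = fun i : Fin 3 =>
        ((e i.succ : Fin k → ℝ) - e 0) := by
      funext i
      simp only [Function.comp_apply, map_sub, hτ]
    rw [h8]
    exact h7
  exact h6.of_comp φ

theorem exists_nat_bound {ι κ : Type} [Fintype ι] [Fintype κ] (coeff : κ → ι → ℤ) :
    ∃ K : ℕ, ∀ j, ∑ i, |coeff j i| ≤ K := by
  have h0 : ∀ j, 0 ≤ ∑ i, |coeff j i| := fun j => Finset.sum_nonneg fun _ _ => abs_nonneg _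
  refine ⟨(∑ j, ∑ i, |coeff j i|).toNat, fun j => ?_⟩
  rw [Int.toNat_of_nonneg (Finset.sum_nonneg fun j _ => h0 j)]
  exact Finset.single_le_sum (f := fun j => ∑ i, |coeff j i|) (fun j _ => h0 j) (Finset.mem_univ j)

/-- Strict convexity of the sphere: the squared distances from three points to their centroid sum to
`|y 1|² + |y 2|² + |y 3|² - 3 |y 0|²`, which vanishes. -/
theorem forcesEqOnSpheres_centroid :
    ForcesEqOnSpheres (fun _ : Unit => (![-3, 1, 1, 1] : Fin 4 → ℤ)) 0 1 := by
  intro n r y hy hr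
  have h1 : ∀ s, y 1 s + y 2 s + y 3 s = 3 * y 0 s := by
    intro s
    have := hy () s
    simp [Fin.sum_univ_four] at this
    linarith
  have h2 : ∑ s, ((y 1 s - y 0 s) ^ 2 + (y 2 s - y 0 s) ^ 2 + (y 3 s - y 0 s) ^ 2) = 0 := by
    calc _ = ∑ s, (y 1 s ^ 2 + y 2 s ^ 2 + y 3 s ^ 2 - 3 * y 0 s ^ 2) :=
          Finset.sum_congr rfl fun s _ => by linear_combination (-2 * y 0 s) * h1 s
      _ = 0 := by
          rw [Finset.sum_sub_distrib, Finset.sum_add_distrib, Finset.sum_add_distrib,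
            ← Finset.mul_sum, hr, hr, hr, hr]
          ring
  rw [Finset.sum_eq_zero_iff_of_nonneg (fun s _ => by positivity)] at h2
  funext s
  have h3 := h2 s (Finset.mem_univ s)
  have h4 : (y 1 s - y 0 s) ^ 2 = 0 := by
    nlinarith [sq_nonneg (y 1 s - y 0 s), sq_nonneg (y 2 s - y 0 s), sq_nonneg (y 3 s - y 0 s)]
  exact sub_eq_zero.1 (pow_eq_zero_iff two_ne_zero |>.1 h4)

theorem nonempty_rigidPattern_of_affineDim {k : ℕ} {T : Finset (Fin k → ℤ)}
    (hT : 3 ≤ affineDim T) : Nonempty (RigidPattern T) := by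
  obtain ⟨τ, hτ, hind⟩ := exists_affineIndependent_points hT
  obtain ⟨M, hM, h⟩ := exists_dotForm_eq _ hind
  -- The two vectors have zero sum and are orthogonal, which is what the relations for `u`, `v` and
  -- `u * v` require.
  obtain ⟨wu, hu⟩ := h ![1, -1, 0]
  obtain ⟨wv, hv⟩ := h ![1, 1, -2]
  have hu' : ∀ i : Fin 3, dotForm wu (τ i.succ) = dotForm wu (τ 0) + M * ![1, -1, 0] i :=
    fun i => by rw [← hu, map_sub]; ring
  have hv' : ∀ i : Fin 3, dotForm wv (τ i.succ) = dotForm wv (τ 0) + M * ![1, 1, -2] i :=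
    fun i => by rw [← hv, map_sub]; ring
  have u1 := hu' 0
  have u2 := hu' 1
  have u3 := hu' 2
  have v1 := hv' 0
  have v2 := hv' 1
  have v3 := hv' 2
  simp at u1 u2 u3 v1 v2 v3
  have hne : (M • dotForm wv + M • dotForm wu) (τ 1 - τ 0) ≠ 0 := by
    simp only [LinearMap.add_apply, LinearMap.smul_apply, map_sub, u1, v1, smul_eq_mul]
    ring_nf
    positivity
  obtain ⟨c, hc⟩ := exists_apply_single_ne_zero _ hne
  refine ⟨{ ι := Fin 4, κ := Unit, τ := τ, mem := hτ, coeff := fun _ => ![-3, 1, 1, 1], K := 6,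
            coeff_le := ?_, u := dotForm wu, v := dotForm wv, sum_coeff := ?_, sum_u := ?_, sum_v := ?_,
            sum_uv := ?_, i₀ := 0, i₁ := 1, rigid := forcesEqOnSpheres_centroid, c := c, ndeg := ?_ }⟩
  · intro _; simp [Fin.sum_univ_four]
  · intro _; simp [Fin.sum_univ_four]
  · intro _; simp [Fin.sum_univ_four, u1, u2, u3]; ring
  · intro _; simp [Fin.sum_univ_four, v1, v2, v3]; ring
  · intro _; simp [Fin.sum_univ_four, u1, u2, u3, v1, v2, v3]; ring
  · rw [u1, v1]
    simpa using hc

/-! ### Rigidity from five points. -/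

theorem quartic_coeffs_eq_zero {a : Fin 5 → ℤ} (ha : Function.Injective a) {c₄ c₃ c₂ c₁ c₀ : ℤ}
    (h : ∀ q, c₄ * a q ^ 4 + c₃ * a q ^ 3 + c₂ * a q ^ 2 + c₁ * a q + c₀ = 0) :
    c₄ = 0 ∧ c₂ = 0 := by
  open Polynomial in
  set P : ℤ[X] := C c₄ * X ^ 4 + C c₃ * X ^ 3 + C c₂ * X ^ 2 + C c₁ * X + C c₀ with hP
  have hdeg : P.natDegree ≤ 4 := by rw [hP]; compute_degree
  have h0 : P = 0 := Polynomial.eq_zero_of_natDegree_lt_card_of_eval_eq_zero P ha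
    (fun q => by simpa [hP] using h q) (by simpa using Nat.lt_succ_of_le hdeg)
  constructor
  · have := congrArg (fun Q => Polynomial.coeff Q 4) h0
    simpa [hP, Polynomial.coeff_X, Polynomial.coeff_C, -eq_intCast] using this
  · have := congrArg (fun Q => Polynomial.coeff Q 2) h0
    simpa [hP, Polynomial.coeff_X, Polynomial.coeff_C, -eq_intCast] using this

/-- For each point `a q`, the relation expressing the value at `a q` of a quadratic polynomial by
its values at `a 0, a 1, a 2`, with denominators cleared. -/
def interpolationCoeff (a : Fin 5 → ℤ) (q i : Fin 5) : ℤ :=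
  (![(a q - a 1) * (a q - a 2) * (a 2 - a 1), -((a q - a 0) * (a q - a 2) * (a 2 - a 0)),
    (a q - a 0) * (a q - a 1) * (a 1 - a 0), 0, 0] : Fin 5 → ℤ) i
    - if i = q then (a 1 - a 0) * (a 2 - a 0) * (a 2 - a 1) else 0

theorem sum_interpolationCoeff_mul (a : Fin 5 → ℤ) (q : Fin 5) (y : Fin 5 → ℤ) :
    ∑ i, interpolationCoeff a q i * y i =
      (a q - a 1) * (a q - a 2) * (a 2 - a 1) * y 0
      - (a q - a 0) * (a q - a 2) * (a 2 - a 0) * y 1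
      + (a q - a 0) * (a q - a 1) * (a 1 - a 0) * y 2
      - (a 1 - a 0) * (a 2 - a 0) * (a 2 - a 1) * y q := by
  simp only [interpolationCoeff, sub_mul, Finset.sum_sub_distrib, ite_mul, zero_mul,
    Finset.sum_ite_eq', Finset.mem_univ, if_true, Fin.sum_univ_five]
  simp
  ring

/-- The relations put the `y q` on a quadratic curve evaluated at `a q`. Its squared norm is a
quartic in `a q`, constant at five points, hence constant. The top coefficient `|α|²` vanishes, then
the quadratic one reduces to `|β|²`, so the curve is constant. -/
theorem forcesEqOnSpheres_interpolation {a : Fin 5 → ℤ} (ha : Function.Injective a) :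
    ForcesEqOnSpheres (interpolationCoeff a) 0 1 := by
  intro n r y hy hr
  set V := (a 1 - a 0) * (a 2 - a 0) * (a 2 - a 1) with hV
  have hV0 : V ≠ 0 := by
    have h1 : a 1 - a 0 ≠ 0 := sub_ne_zero.2 (ha.ne (by decide))
    have h2 : a 2 - a 0 ≠ 0 := sub_ne_zero.2 (ha.ne (by decide))
    have h3 : a 2 - a 1 ≠ 0 := sub_ne_zero.2 (ha.ne (by decide))
    positivity
  set α : Fin n → ℤ := fun s =>
    (a 2 - a 1) * y 0 s - (a 2 - a 0) * y 1 s + (a 1 - a 0) * y 2 s with hα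
  set β : Fin n → ℤ := fun s => -((a 1 + a 2) * (a 2 - a 1) * y 0 s)
    + (a 0 + a 2) * (a 2 - a 0) * y 1 s - (a 0 + a 1) * (a 1 - a 0) * y 2 s with hβ
  set γ : Fin n → ℤ := fun s => a 1 * a 2 * (a 2 - a 1) * y 0 s
    - a 0 * a 2 * (a 2 - a 0) * y 1 s + a 0 * a 1 * (a 1 - a 0) * y 2 s with hγ
  have hQ : ∀ q s, V * y q s = α s * a q ^ 2 + β s * a q + γ s := by
    intro q s
    have h1 := hy q s
    rw [sum_interpolationCoeff_mul a q (fun i => y i s)] at h1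
    simp only [hα, hβ, hγ]
    linear_combination -h1
  have hquart : ∀ q, (∑ s, α s ^ 2) * a q ^ 4 + (∑ s, 2 * α s * β s) * a q ^ 3
      + (∑ s, (β s ^ 2 + 2 * α s * γ s)) * a q ^ 2 + (∑ s, 2 * β s * γ s) * a q
      + (∑ s, γ s ^ 2 - V ^ 2 * r) = 0 := by
    intro q
    have h1 : V ^ 2 * r = ∑ s, (α s * a q ^ 2 + β s * a q + γ s) ^ 2 := by
      rw [← hr q, Finset.mul_sum]
      exact Finset.sum_congr rfl fun s _ => by rw [← hQ]; ring
    rw [h1, Finset.sum_mul, Finset.sum_mul, Finset.sum_mul, Finset.sum_mul,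
      ← Finset.sum_sub_distrib, ← Finset.sum_add_distrib, ← Finset.sum_add_distrib,
      ← Finset.sum_add_distrib, ← Finset.sum_add_distrib]
    exact Finset.sum_eq_zero fun s _ => by ring
  obtain ⟨h4, h2⟩ := quartic_coeffs_eq_zero ha hquart
  rw [Finset.sum_eq_zero_iff_of_nonneg (fun s _ => sq_nonneg _)] at h4
  have hα0 : ∀ s, α s = 0 := fun s => by simpa using h4 s (Finset.mem_univ s)
  simp only [hα0, mul_zero, zero_mul, add_zero] at h2
  rw [Finset.sum_eq_zero_iff_of_nonneg (fun s _ => sq_nonneg _)] at h2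
  have hβ0 : ∀ s, β s = 0 := fun s => by simpa using h2 s (Finset.mem_univ s)
  funext s
  refine mul_left_cancel₀ hV0 ?_
  rw [hQ, hQ, hα0, hβ0]
  ring

theorem nonempty_rigidPattern_of_card {k : ℕ} {T : Finset (Fin k → ℤ)}
    (hT : 5 ≤ T.card) : Nonempty (RigidPattern T) := by
  obtain ⟨w, hw⟩ := exists_injOn_dotForm T
  obtain ⟨e⟩ : Nonempty (Fin 5 ↪ T) :=
    Function.Embedding.nonempty_of_card_le (by simpa using hT)
  set a : Fin 5 → ℤ := fun i => dotForm w (e i) with ha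
  have hinj : Function.Injective a := fun i j hij =>
    e.injective (Subtype.ext (hw (e i).2 (e j).2 hij))
  obtain ⟨K, hK⟩ := exists_nat_bound (interpolationCoeff a)
  have h10 : a 1 - a 0 ≠ 0 := sub_ne_zero.2 (hinj.ne (by decide))
  obtain ⟨c, hc⟩ := exists_apply_single_ne_zero (dotForm w)
    (x := (e 1 : Fin k → ℤ) - e 0) (by rw [map_sub]; exact h10)
  refine ⟨{ ι := Fin 5, κ := Fin 5, τ := fun i => e i, mem := fun i => (e i).2,
            coeff := interpolationCoeff a, K := K, coeff_le := hK, u := dotForm w, v := dotForm w,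
            sum_coeff := ?_, sum_u := ?_, sum_v := ?_, sum_uv := ?_, i₀ := 0, i₁ := 1,
            rigid := forcesEqOnSpheres_interpolation hinj, c := c, ndeg := ?_ }⟩
  · intro j
    have := sum_interpolationCoeff_mul a j (fun _ => 1)
    simp only [mul_one] at this
    rw [this]; ring
  · intro j
    exact (sum_interpolationCoeff_mul a j a).trans (by ring)
  · intro j
    exact (sum_interpolationCoeff_mul a j a).trans (by ring)
  · intro j
    exact (sum_interpolationCoeff_mul a j (fun i => a i * a i)).trans (by ring)
  · change (a 1 - a 0) * dotForm w (Pi.single c 1) + (a 1 - a 0) * dotForm w (Pi.single c 1) ≠ 0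
    have := mul_ne_zero h10 hc
    omega

/-! ### Choice of parameters. -/

/-- Handles `δ` bounded below, where any set of size `⌈δ N^k⌉` works: each translate is determined
by one of its points, and the gap `√δ - δ` absorbs the rounding. -/
theorem exists_set_of_half_pow {k : ℕ} {T : Finset (Fin k → ℤ)} (hk : k ≠ 0) {t : Fin k → ℤ}
    (ht : t ∈ T) {δ : ℝ} (hδ : 0 < δ) (hδ1 : δ < 1) :
    ∃ N₀ : ℕ, ∀ N : ℕ, N₀ ≤ N → ∃ A : Finset (Fin k → ℤ), A ⊆ gridBox k N ∧
      δ * (N : ℝ) ^ k ≤ (A.card : ℝ) ∧ ∀ d : ℤ, d ≠ 0 → (patternTranslates T A d).Finite ∧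
        ((patternTranslates T A d).ncard : ℝ) ≤ √δ * (N : ℝ) ^ k := by
  have hsq : √δ * √δ = δ := Real.mul_self_sqrt hδ.le
  have hs0 : 0 < √δ := Real.sqrt_pos.2 hδ
  have hs1 : √δ < 1 := by rw [Real.sqrt_lt' one_pos]; simpa using hδ1
  have hgap : 0 < √δ - δ := by nlinarith
  refine ⟨⌈1 / (√δ - δ)⌉₊ + 1, fun N hN => ?_⟩
  have hN1 : 1 / (√δ - δ) ≤ N := (Nat.le_ceil _).trans (by exact_mod_cast (by omega))
  have hNk : (N : ℝ) ≤ (N : ℝ) ^ k := le_self_pow₀ (by exact_mod_cast (by omega)) hk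
  have hceil : ⌈δ * (N : ℝ) ^ k⌉₊ ≤ (gridBox k N).card := by
    rw [card_gridBox, Nat.ceil_le]
    push_cast
    exact mul_le_of_le_one_left (by positivity) hδ1.le
  obtain ⟨A, hA, hAc⟩ := Finset.exists_subset_card_eq hceil
  refine ⟨A, hA, by rw [hAc]; exact Nat.le_ceil _, fun d _ => ?_⟩
  obtain ⟨h1, h2⟩ := finite_and_ncard_patternTranslates_le (T := T) (A := A) (d := d) A
    (fun x hx => hx t ht)
  refine ⟨h1, ?_⟩
  have h3 : ((patternTranslates T A d).ncard : ℝ) ≤ A.card := by exact_mod_cast h2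
  have h4 : (A.card : ℝ) < δ * (N : ℝ) ^ k + 1 := by
    rw [hAc]; exact Nat.ceil_lt_add_one (by positivity)
  rw [div_le_iff₀ hgap] at hN1
  nlinarith

theorem RigidPattern.exists_const {k : ℕ} {T : Finset (Fin k → ℤ)} (R : RigidPattern T) :
    ∃ c : ℝ, 0 < c ∧ ∀ δ : ℝ, 0 < δ → δ < 1 / 2 → ∃ N₀ : ℕ, ∀ N : ℕ, N₀ ≤ N →
      ∃ A : Finset (Fin k → ℤ), A ⊆ gridBox k N ∧ δ * (N : ℝ) ^ k ≤ (A.card : ℝ) ∧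
        ∀ d : ℤ, d ≠ 0 → (patternTranslates T A d).Finite ∧
          ((patternTranslates T A d).ncard : ℝ) ≤
            δ ^ (c * Real.log (1 / δ)) * (N : ℝ) ^ k := by
  -- `K ≥ 16` lets `√K` absorb the factor 4 in the count.
  set K := R.K + 16 with hK
  have hK16 : (16 : ℝ) ≤ K := by rw [hK]; push_cast; linarith [Nat.cast_nonneg (α := ℝ) R.K]
  have hK0 : (0 : ℝ) < K := by linarith
  set ℓ := Real.log K with hℓ
  have hexpℓ : Real.exp ℓ = K := Real.exp_log hK0
  have hℓ0 : 0 < ℓ := Real.log_pos (by linarith)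
  refine ⟨1 / (400 * ℓ), by positivity, fun δ hδ hδ2 => ?_⟩
  set L := Real.log (1 / δ) with hL
  have hδL : δ = Real.exp (-L) := by rw [hL, one_div, Real.log_inv, neg_neg, Real.exp_log hδ]
  have hL0 : 0 < L := Real.log_pos (by rw [lt_div_iff₀ hδ]; linarith)
  have hpow : δ ^ (1 / (400 * ℓ) * L) = Real.exp (-(L ^ 2 / (400 * ℓ))) := by
    rw [hδL, ← Real.exp_mul]; congr 1; field_simp
  rw [hpow]
  by_cases hbig : L < 7 * ℓ
  · obtain ⟨N₀, h⟩ := exists_set_of_half_pow (T := T) R.c.pos.ne' (R.mem R.i₀) hδ (by linarith)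
    refine ⟨N₀, fun N hN => ?_⟩
    obtain ⟨A, hA, hAc, hd⟩ := h N hN
    refine ⟨A, hA, hAc, fun d hd0 => ⟨(hd d hd0).1, (hd d hd0).2.trans ?_⟩⟩
    refine mul_le_mul_of_nonneg_right ?_ (by positivity)
    rw [Real.sqrt_eq_rpow]
    conv_lhs => rw [hδL, ← Real.exp_mul]
    rw [Real.exp_le_exp]
    have : L ^ 2 / (400 * ℓ) ≤ L * (1 / 2) := by
      rw [div_le_iff₀ (by positivity)]; nlinarith
    linarith
  · push Not at hbig
    -- The inverse density is at most `K^(4n+3) ≤ K^(7n)`, whence the 7. Rounding gives `L ≤ 14 n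
    -- ℓ`, and `14² = 196 ≤ 400 / 2` explains the constant 400.
    set n := ⌊L / (7 * ℓ)⌋₊ with hn
    have hn1 : 1 ≤ n := Nat.le_floor (by rw [Nat.cast_one, le_div_iff₀ (by positivity)]; linarith)
    have hn1' : (1 : ℝ) ≤ n := by exact_mod_cast hn1
    have hnL : n * (7 * ℓ) ≤ L := by
      rw [← le_div_iff₀ (by positivity)]; exact Nat.floor_le (by positivity)
    have hLn : L ≤ n * (14 * ℓ) := by
      have h1 : L / (7 * ℓ) < n + 1 := Nat.lt_floor_add_one _
      rw [div_lt_iff₀ (by positivity)] at h1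
      nlinarith
    have hKn : ∀ e : ℕ, (K : ℝ) ^ e = Real.exp (e * ℓ) := fun e => by
      rw [Real.exp_nat_mul, hexpℓ]
    obtain ⟨N₀, h⟩ := R.exists_set (K := K) (n := n) (m := K ^ n) (by omega) (by omega) hn1
      (Nat.one_le_pow _ _ (by omega))
    refine ⟨N₀, fun N hN => ?_⟩
    obtain ⟨A, hA, hAc, hd⟩ := h N hN
    refine ⟨A, hA, ?_, fun d hd0 => ⟨(hd d hd0).1, ?_⟩⟩
    · have h1 : 2 * K ^ (n + 2) * n * (K ^ n) ^ 2 ≤ K ^ (7 * n) := by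
        calc 2 * K ^ (n + 2) * n * (K ^ n) ^ 2 ≤ K * K ^ (n + 2) * K ^ n * (K ^ n) ^ 2 := by
              gcongr
              · omega
              · exact (Nat.lt_pow_self (by omega)).le
          _ = K ^ (4 * n + 3) := by ring
          _ ≤ K ^ (7 * n) := Nat.pow_le_pow_right (by omega) (by omega)
      have h2 : (N : ℝ) ^ k ≤ A.card * (K : ℝ) ^ (7 * n) := by
        exact_mod_cast hAc.trans (Nat.mul_le_mul_left _ h1)
      have h3 : δ * (K : ℝ) ^ (7 * n) ≤ 1 := by
        rw [hKn, hδL, ← Real.exp_add, Real.exp_le_one_iff]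
        push_cast
        linarith
      calc δ * (N : ℝ) ^ k ≤ δ * (A.card * (K : ℝ) ^ (7 * n)) := by gcongr
        _ = (δ * (K : ℝ) ^ (7 * n)) * A.card := by ring
        _ ≤ 1 * A.card := mul_le_mul_of_nonneg_right h3 (Nat.cast_nonneg _)
        _ = A.card := one_mul _
    · have h1 : ((patternTranslates T A d).ncard : ℝ) * (K : ℝ) ^ (n * n) ≤ 4 * (N : ℝ) ^ k := by
        have := (hd d hd0).2
        rw [← pow_mul] at this
        exact_mod_cast this
      have h4 : (4 : ℝ) ≤ Real.exp (ℓ / 2) := by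
        have h5 : Real.exp (ℓ / 2) * Real.exp (ℓ / 2) = K := by
          rw [← Real.exp_add, add_halves, hexpℓ]
        nlinarith [Real.exp_pos (ℓ / 2)]
      have h6 : (4 : ℝ) ≤ Real.exp (-(L ^ 2 / (400 * ℓ))) * (K : ℝ) ^ (n * n) := by
        rw [hKn, ← Real.exp_add]
        refine h4.trans (Real.exp_le_exp.2 ?_)
        have h7 : L ^ 2 / (400 * ℓ) ≤ n * n * ℓ / 2 := by
          rw [div_le_iff₀ (by positivity)]
          nlinarith [mul_le_mul hLn hLn hL0.le (by positivity)]
        have h8 : ℓ ≤ n * n * ℓ := le_mul_of_one_le_left hℓ0.le (by nlinarith)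
        push_cast
        linarith
      have hKp : (0 : ℝ) < (K : ℝ) ^ (n * n) := by positivity
      refine le_of_mul_le_mul_right (h1.trans ?_) hKp
      calc 4 * (N : ℝ) ^ k ≤ Real.exp (-(L ^ 2 / (400 * ℓ))) * (K : ℝ) ^ (n * n) * (N : ℝ) ^ k := by
            gcongr
        _ = _ := by ring

theorem corollary1p8 (k : ℕ) (T : Finset (Fin k → ℤ))
    (hT : 3 ≤ affineDim T ∨ 5 ≤ T.card) :
    ∃ c : ℝ, 0 < c ∧
      ∀ δ : ℝ, 0 < δ → δ < 1 / 2 →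
        ∃ N₀ : ℕ, ∀ N : ℕ, N₀ ≤ N →
          ∃ A : Finset (Fin k → ℤ), A ⊆ gridBox k N ∧
            δ * (N : ℝ) ^ k ≤ (A.card : ℝ) ∧
            ∀ d : ℤ, d ≠ 0 →
              (patternTranslates T A d).Finite ∧
              ((patternTranslates T A d).ncard : ℝ) ≤
                δ ^ (c * Real.log (1 / δ)) * (N : ℝ) ^ k :=
  (hT.elim nonempty_rigidPattern_of_affineDim nonempty_rigidPattern_of_card).elim fun R => R.exists_const
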